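/- Let $G=(V,w,m)$ be a measured and weighted graph: $V$ is countable, $w:V\times V\to[0,\infty)$ is symmetric and vanishes on the diagonal, $m:V\to(0,\infty)$, every $x\in V$ has only finitely many $y$ with $w(x,y)>0$, and $G$ is connected. Put $q(x,y)=w(x,y)/m(x)$ and assume $\sup_{x}\sum_{y}q(x,y)<\infty$. Let $$\Delta f(x)=\sum_{y}q(x,y)(f(y)-f(x)),\qquad \Gamma(f,g)=\tfrac12\big(\Delta(fg)-f\Delta g-g\Delta f\big),$$ $$\Gamma_2(f,g)=\tfrac12\big(\Delta\Gamma(f,g)-\Gamma(f,\Delta g)-\Gamma(g,\Delta f)\big),\qquad \Gamma f=\Gamma(f,f),\quad \Gamma_2 f=\Gamma_2(f,f),$$ and let $P_t=e^{t\Delta}$, $t\ge 0$, be the heat semigroup on $\ell_\infty(V)$ (the operator exponential; $\Delta$ is a bounded operator on $\ell_\infty(V)$ because the degrees are bounded). Let $K,T>0$, $n\in(0,\infty]$ (with $1/\infty=0$) and $\rho:V\to\mathbb{R}$. Assume that $G$ satisfies $CD(\rho,n)$, i.e. for all bounded $f:V\to\mathbb{R}$ and all $x\in V$, $$\Gamma_2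 f(x)\ \ge\ \rho(x)\,\Gamma f(x)+\tfrac1n(\Delta f(x))^2 ,$$ and that $$k_T\big((\rho-K)_-\big)\le \tfrac14\left(1-e^{-KT/2}\right),$$ where $a_-=-\min\{0,a\}$ and, for $W:V\to[0,\infty)$, $k_T(W)=\sup_{k\in\mathbb{N}}\int_0^T\|P_t(k\wedge W)\|_\infty\,dt\in[0,\infty]$. Then for all $f\in\ell_\infty(V)$ and all $t>0$, pointwise on $V$, $$\Gamma P_t f\ \le\ K e^{KT}\,\frac{1}{\sinh(Kt)}\,\|f\|_\infty^2\ \le\ \frac{e^{KT}}{t}\,\|f\|_\infty^2 .$$ -/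

import Mathlib

open scoped NNReal ENNReal

noncomputable section

/-- `ℓ_∞(V)`, the Banach space of bounded real functions on `V` with the supremum norm. It is
Mathlib's space `lp`, of which only the normed space structure is kept. -/
def Linf (V : Type*) : Type _ := lp (fun _ : V => ℝ) ∞

namespace Linf

variable {V : Type*}

instance : NormedAddCommGroup (Linf V) := inferInstanceAs (NormedAddCommGroup (lp (fun _ : V => ℝ) ∞))

instance : NormedSpace ℝ (Linf V) := inferInstanceAs (NormedSpace ℝ (lp (fun _ : V => ℝ) ∞))

instance : CompleteSpace (Linf V) := inferInstanceAs (CompleteSpace (lp (fun _ : V => ℝ) ∞))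

instance : CoeFun (Linf V) (fun _ => V → ℝ) := ⟨fun f => f.1⟩

@[ext] theorem ext {f g : Linf V} (h : ∀ x, f x = g x) : f = g := Subtype.ext (funext h)

@[simp] theorem add_apply (f g : Linf V) (x : V) : (f + g) x = f x + g x := rfl

@[simp] theorem smul_apply (c : ℝ) (f : Linf V) (x : V) : (c • f) x = c * f x := rfl

theorem norm_def (f : Linf V) : ‖f‖ = ⨆ x, |f x| := lp.norm_eq_ciSup (E := fun _ : V => ℝ) f

theorem abs_apply_le (f : Linf V) (x : V) : |f x| ≤ ‖f‖ :=
  lp.norm_apply_le_norm (E := fun _ : V => ℝ) ENNReal.top_ne_zero f x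

theorem norm_le {f : Linf V} {C : ℝ} (hC : 0 ≤ C) (h : ∀ x, |f x| ≤ C) : ‖f‖ ≤ C :=
  lp.norm_le_of_forall_le (E := fun _ : V => ℝ) hC h

/-- A bounded function as an element of `ℓ_∞(V)`. -/
def mk (f : V → ℝ) (C : ℝ) (h : ∀ x, |f x| ≤ C) : Linf V :=
  ⟨f, memℓp_infty ⟨C, by rintro _ ⟨x, rfl⟩; exact h x⟩⟩

@[simp] theorem mk_apply (f : V → ℝ) (C : ℝ) (h : ∀ x, |f x| ≤ C) (x : V) : mk f C h x = f x := rfl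

end Linf

/-- A measured and weighted graph `(V, w, m)`: countable, locally finite and connected. -/
structure MeasuredWeightedGraph (V : Type*) where
  countable : Countable V
  /-- the symmetric edge weight -/
  w : V → V → ℝ
  /-- the vertex measure -/
  m : V → ℝ
  w_nonneg : ∀ x y, 0 ≤ w x y
  w_symm : ∀ x y, w x y = w y x
  w_self : ∀ x, w x x = 0
  m_pos : ∀ x, 0 < m x
  locallyFinite : ∀ x, {y | 0 < w x y}.Finite
  connected : ∀ x y, Relation.ReflTransGen (fun a b => 0 < w a b) x y

namespace MeasuredWeightedGraph

variable {V : Type*} (G : MeasuredWeightedGraph V)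

/-- The finite set of neighbours of `x`. -/
def nbrs (x : V) : Finset V := (G.locallyFinite x).toFinset

/-- `q(x,y) = w(x,y) / m(x)`. -/
def q (x y : V) : ℝ := G.w x y / G.m x

/-- `Deg(x) = ∑_y q(x,y)`; only neighbours `y` of `x` contribute. -/
def deg (x : V) : ℝ := ∑ y ∈ G.nbrs x, G.q x y

/-- `Deg_max = sup_x Deg(x) < ∞`. -/
def BoundedDegree : Prop := BddAbove (Set.range G.deg)

/-- `Δ f(x) = ∑_y q(x,y) (f(y) - f(x))`; only neighbours `y` of `x` contribute. -/
def lap (f : V → ℝ) (x : V) : ℝ := ∑ y ∈ G.nbrs x, G.q x y * (f y - f x)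

/-- The carré du champ operator `Γ(f,g) = (Δ(fg) - f Δg - g Δf) / 2`. -/
def gam (f g : V → ℝ) (x : V) : ℝ :=
  1 / 2 * (G.lap (f * g) x - f x * G.lap g x - g x * G.lap f x)

/-- The iterated operator `Γ₂(f,g) = (Δ Γ(f,g) - Γ(f,Δg) - Γ(g,Δf)) / 2`. -/
def gam2 (f g : V → ℝ) (x : V) : ℝ :=
  1 / 2 * (G.lap (G.gam f g) x - G.gam f (G.lap g) x - G.gam g (G.lap f) x)

/-- The variable curvature dimension condition `CD(ρ,n)`, for `n ∈ (0,∞]` (with `1/∞ = 0`):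
`Γ₂ f ≥ ρ Γ f + (1/n) (Δ f)²` for all bounded `f`. -/
def CD (ρ : V → ℝ) (n : ℝ≥0∞) : Prop :=
  ∀ f : V → ℝ, (∃ C, ∀ x, |f x| ≤ C) → ∀ x,
    ρ x * G.gam f f x + (n⁻¹).toReal * (G.lap f x) ^ 2 ≤ G.gam2 f f x

theorem q_nonneg (x y : V) : 0 ≤ G.q x y := div_nonneg (G.w_nonneg x y) (G.m_pos x).le

theorem abs_lap_le (f : Linf V) (x : V) :
    |G.lap f x| ≤ 2 * G.deg x * ‖f‖ := by
  have hf := f.abs_apply_le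
  have e : 2 * G.deg x * ‖f‖ = ∑ y ∈ G.nbrs x, G.q x y * (2 * ‖f‖) := by
    rw [← Finset.sum_mul, deg]; ring
  rw [e]
  refine (Finset.abs_sum_le_sum_abs _ _).trans (Finset.sum_le_sum fun y _ => ?_)
  rw [abs_mul, abs_of_nonneg (G.q_nonneg x y)]
  refine mul_le_mul_of_nonneg_left ?_ (G.q_nonneg x y)
  have h1 := abs_sub (f y) (f x)
  have h2 := hf x
  have h3 := hf y
  linarith

variable {G}

theorem BoundedDegree.abs_lap_le (h : G.BoundedDegree) (f : Linf V) (x : V) :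
    |G.lap f x| ≤ 2 * h.some * ‖f‖ := by
  refine (G.abs_lap_le f x).trans (mul_le_mul_of_nonneg_right ?_ (norm_nonneg f))
  have := h.some_mem (Set.mem_range_self x)
  linarith

/-- On a graph of bounded degree, `Δ` as a bounded operator on `ℓ_∞(V)`. -/
def BoundedDegree.lapL (h : G.BoundedDegree) : Linf V →L[ℝ] Linf V :=
  LinearMap.mkContinuousOfExistsBound
    { toFun := fun f => Linf.mk (G.lap f) (2 * h.some * ‖f‖) (h.abs_lap_le f)
      map_add' := fun f g => by
        ext x
        simp only [Linf.mk_apply, Linf.add_apply, lap, ← Finset.sum_add_distrib]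
        exact Finset.sum_congr rfl fun y _ => by ring
      map_smul' := fun c f => by
        ext x
        simp only [Linf.mk_apply, Linf.smul_apply, lap, RingHom.id_apply, Finset.mul_sum]
        exact Finset.sum_congr rfl fun y _ => by ring }
    ⟨2 * |h.some|, fun f => Linf.norm_le (by positivity) fun x =>
      (h.abs_lap_le f x).trans (by have := le_abs_self h.some; gcongr)⟩

theorem BoundedDegree.lapL_apply (h : G.BoundedDegree) (f : Linf V) (x : V) :
    h.lapL f x = G.lap f x := rfl

/-- The heat semigroup `P_t = e^{-tL}`, `L = -Δ`, acting on `ℓ_∞(V)`. On a graph of bounded degree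
the generator is a bounded operator, so this is the operator exponential. -/
def BoundedDegree.heat (h : G.BoundedDegree) (t : ℝ) : Linf V →L[ℝ] Linf V :=
  NormedSpace.exp (t • h.lapL)

/-- The truncation `k ∧ W` of a nonnegative function, an element of `ℓ_∞(V)`. -/
def trunc (k : ℕ) (W : V → ℝ≥0) : Linf V :=
  Linf.mk (fun x => min (k : ℝ) (W x)) k fun x => by
    rw [abs_of_nonneg (le_min k.cast_nonneg (W x).coe_nonneg)]
    exact min_le_left _ _

/-- The Kato constant `k_T(W) = sup_k ∫_0^T ‖P_t (k ∧ W)‖_∞ dt ∈ [0,∞]` of `W : V → [0,∞)`. -/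
def BoundedDegree.kato (h : G.BoundedDegree) (T : ℝ) (W : V → ℝ≥0) : ℝ≥0∞ :=
  ⨆ k : ℕ, ∫⁻ t in Set.Ioc 0 T, ‖h.heat t (trunc k W)‖ₑ

/-- The negative part `f_-(x) = -min{0, f(x)}` of a function. -/
def negPartFun (f : V → ℝ) : V → ℝ≥0 :=
  fun x => ⟨-min 0 (f x), neg_nonneg.mpr (min_le_left _ _)⟩

end MeasuredWeightedGraph

end

/-!
For `Γ₂ ≥ (K - W) Γ` the Bakry–Émery interpolation `g(s) = (P_s f)² + b(s) Γ(P_s f)`, where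
`b(0) = 0` and `b' = 2 + 2 K b`, is a subsolution of `g' = (Δ + 2W) g`; comparing with the positive
semigroup of `Δ + 2W` gives `b(t) Γ(P_t f) ≤ e^{t(Δ + 2W)} f² ≤ ‖f‖² e^{t(Δ + 2W)} 1`. If the
potential `∫_0^s P_r W dr` is at most `κ < 1/2` for `s ≤ T`, then `1 + c ∫_0^s P_r (2W) dr` is a
supersolution of the same equation for `c = (1 - 2κ)⁻¹` (Khas'minskii), so that
`e^{t(Δ + 2W)} 1 ≤ c` for `t ≤ T` and, iterating, `e^{t(Δ + 2W)} 1 ≤ c^{1 + t/T}` for all `t`.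
On a graph whose degrees are bounded by `D` one has `P_r W ≥ e^{-rD} W`, so a finite Kato constant
forces `W` to be bounded.
-/

open NormedSpace Set

theorem mul_integral_exp_mul (a t : ℝ) :
    a * ∫ r in (0 : ℝ)..t, Real.exp (a * r) = Real.exp (a * t) - 1 := by
  rw [intervalIntegral.mul_integral_comp_mul_left, integral_exp, mul_zero, Real.exp_zero]

section BanachAlgebra

variable {𝔸 : Type*} [NormedRing 𝔸] [NormedAlgebra ℝ 𝔸] [CompleteSpace 𝔸]

theorem exp_add_smul_one (a : 𝔸) (r : ℝ) : exp (a + r • 1) = Real.exp r • exp a := by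
  let _ : NormedAlgebra ℚ 𝔸 := NormedAlgebra.restrictScalars ℚ ℝ 𝔸
  rw [exp_add_of_commute ((Commute.one_right a).smul_right r), ← Algebra.algebraMap_eq_smul_one,
    ← algebraMap_exp_comm (𝕂 := ℝ), ← Real.exp_eq_exp_ℝ, Algebra.algebraMap_eq_smul_one,
    mul_smul_comm, mul_one]

theorem exp_add_smul (a : 𝔸) (s t : ℝ) : exp ((s + t) • a) = exp (s • a) * exp (t • a) := by
  let _ : NormedAlgebra ℚ 𝔸 := NormedAlgebra.restrictScalars ℚ ℝ 𝔸
  rw [add_smul]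
  exact exp_add_of_commute (((Commute.refl a).smul_left s).smul_right t)

end BanachAlgebra

section BanachSpace

variable {E : Type*} [NormedAddCommGroup E] [NormedSpace ℝ E]

/-- The potential `∫_0^t e^{rB} w dr` of `w` up to time `t`: the solution of `v' = B v + w` with
`v 0 = 0`. -/
noncomputable def semigroupPotential (B : E →L[ℝ] E) (w : E) (t : ℝ) : E :=
  ∫ r in (0 : ℝ)..t, exp (r • B) w

@[simp] theorem semigroupPotential_zero (B : E →L[ℝ] E) (w : E) : semigroupPotential B w 0 = 0 :=
  intervalIntegral.integral_same

theorem semigroupPotential_smul (B : E →L[ℝ] E) (c : ℝ) (w : E) (t : ℝ) :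
    semigroupPotential B (c • w) t = c • semigroupPotential B w t := by
  simp only [semigroupPotential, map_smul, intervalIntegral.integral_smul]

theorem exp_zero_smul_apply (B : E →L[ℝ] E) (v : E) : exp ((0 : ℝ) • B) v = v := by simp

theorem enorm_semigroupPotential_le_lintegral (B : E →L[ℝ] E) (w : E) {t T : ℝ}
    (ht : t ∈ Icc 0 T) :
    ‖semigroupPotential B w t‖ₑ ≤ ∫⁻ r in Ioc 0 T, ‖exp (r • B) w‖ₑ := by
  rw [semigroupPotential, intervalIntegral.integral_of_le ht.1]
  exact (MeasureTheory.enorm_integral_le_lintegral_enorm _).trans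
    (MeasureTheory.lintegral_mono_set (Ioc_subset_Ioc_right ht.2))

variable [CompleteSpace E]

theorem hasDerivAt_exp_smul_apply (B : E →L[ℝ] E) (v : E) (s : ℝ) :
    HasDerivAt (fun s : ℝ => exp (s • B) v) (B (exp (s • B) v)) s := by
  simpa using (hasDerivAt_exp_smul_const' B s).clm_apply (hasDerivAt_const s v)

theorem continuous_exp_smul_apply (B : E →L[ℝ] E) (v : E) :
    Continuous fun s : ℝ => exp (s • B) v :=
  continuous_iff_continuousAt.2 fun s => (hasDerivAt_exp_smul_apply B v s).continuousAt

theorem hasDerivAt_semigroupPotential (B : E →L[ℝ] E) (w : E) (t : ℝ) :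
    HasDerivAt (semigroupPotential B w) (exp (t • B) w) t :=
  ((continuous_exp_smul_apply B w).integral_hasStrictDerivAt 0 t).hasDerivAt

theorem apply_semigroupPotential (B : E →L[ℝ] E) (w : E) (t : ℝ) :
    B (semigroupPotential B w t) = exp (t • B) w - w := by
  have hcont := continuous_exp_smul_apply B w
  calc B (semigroupPotential B w t)
      = ∫ r in (0 : ℝ)..t, B (exp (r • B) w) :=
        (B.intervalIntegral_comp_comm (hcont.intervalIntegrable 0 t)).symm
    _ = exp (t • B) w - exp ((0 : ℝ) • B) w :=
        intervalIntegral.integral_eq_sub_of_hasDerivAt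
          (fun r _ => hasDerivAt_exp_smul_apply B w r)
          ((B.continuous.comp hcont).intervalIntegrable 0 t)
    _ = exp (t • B) w - w := by simp

end BanachSpace

section OrderedBanachSpace

variable {E : Type*} [NormedAddCommGroup E] [NormedSpace ℝ E] [PartialOrder E]
  [IsOrderedAddMonoid E] [IsOrderedModule ℝ E] [OrderClosedTopology E]

/-- Order version of the mean value inequality; positive functionals, which detect the order by
Hahn-Banach, reduce it to real-valued functions. -/
theorem le_of_hasDerivAt_nonneg {f f' : ℝ → E} {a b : ℝ} (hab : a ≤ b)
    (hf : ∀ s ∈ Icc a b, HasDerivAt f (f' s) s) (hf' : ∀ s ∈ Icc a b, 0 ≤ f' s) : f a ≤ f b := by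
  by_contra hlt
  rw [← sub_nonneg, ← ProperCone.mem_positive (R := ℝ)] at hlt
  obtain ⟨φ, hφ, hneg⟩ := (ProperCone.positive ℝ E).hyperplane_separation_point hlt
  have hderiv : ∀ s ∈ Icc a b, HasDerivAt (fun s => φ (f s)) (φ (f' s)) s := fun s hs =>
    φ.hasFDerivAt.comp_hasDerivAt s (hf s hs)
  have hmono : MonotoneOn (fun s => φ (f s)) (Icc a b) :=
    monotoneOn_of_hasDerivWithinAt_nonneg (convex_Icc a b)
      (fun s hs => (hderiv s hs).continuousAt.continuousWithinAt)
      (fun s hs => (hderiv s (interior_subset hs)).hasDerivWithinAt)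
      fun s hs => hφ _ (hf' s (interior_subset hs))
  have hle : φ (f a) ≤ φ (f b) := hmono (left_mem_Icc.2 hab) (right_mem_Icc.2 hab) hab
  rw [map_sub] at hneg
  linarith

/-- Quasi-positive operators: those that become positive after adding a multiple of the identity.
They are the bounded generators of positive semigroups; for matrices these are the Metzler
matrices. -/
def QuasiPositive (B : E →L[ℝ] E) : Prop := ∃ D : ℝ, Monotone (B + D • (1 : E →L[ℝ] E))

variable [CompleteSpace E]

theorem self_le_exp_apply_of_monotone {A : E →L[ℝ] E} (hA : Monotone A) {v : E} (hv : 0 ≤ v) :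
    v ≤ exp A v := by
  have hpow : ∀ n : ℕ, 0 ≤ (A ^ n) v := fun n => by
    induction n with
    | zero => exact hv
    | succ n ih =>
      rw [pow_succ', mul_apply_eq_comp]
      exact (map_zero A).symm.le.trans (hA ih)
  have hseries := (exp_series_hasSum_exp' (𝕂 := ℝ) A).mapL (ContinuousLinearMap.apply ℝ E v)
  simpa using le_hasSum hseries 0 fun n _ => smul_nonneg (by positivity) (hpow n)

theorem exp_neg_smul_le_exp_smul_apply {B : E →L[ℝ] E} {D : ℝ}
    (hB : Monotone (B + D • (1 : E →L[ℝ] E))) {t : ℝ} (ht : 0 ≤ t) {v : E} (hv : 0 ≤ v) :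
    Real.exp (-(t * D)) • v ≤ exp (t • B) v := by
  have hmono : Monotone (t • (B + D • (1 : E →L[ℝ] E))) := fun _ _ h =>
    smul_le_smul_of_nonneg_left (hB h) ht
  have hshift : t • B = t • (B + D • (1 : E →L[ℝ] E)) + (-(t * D)) • 1 := by module
  rw [hshift, exp_add_smul_one]
  exact smul_le_smul_of_nonneg_left (self_le_exp_apply_of_monotone hmono hv) (Real.exp_pos _).le

namespace QuasiPositive

variable {B : E →L[ℝ] E} (hB : QuasiPositive B)

include hB

theorem monotone_exp_smul {t : ℝ} (ht : 0 ≤ t) : Monotone (exp (t • B) : E →L[ℝ] E) := by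
  obtain ⟨D, hD⟩ := hB
  exact (monotone_iff_map_nonneg _).2 fun v hv =>
    (smul_nonneg (Real.exp_pos _).le hv).trans (exp_neg_smul_le_exp_smul_apply hD ht hv)

/-- Duhamel: `e^{(t-s)B} v(s)` has derivative `e^{(t-s)B} (v' - B v)`. -/
theorem exp_smul_apply_le_of_le_deriv {t : ℝ} (ht : 0 ≤ t) {v v' : ℝ → E}
    (hv : ∀ s ∈ Icc 0 t, HasDerivAt v (v' s) s) (hsup : ∀ s ∈ Icc 0 t, B (v s) ≤ v' s) :
    exp (t • B) (v 0) ≤ v t := by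
  have hderiv : ∀ s ∈ Icc 0 t, HasDerivAt (fun s => exp ((t - s) • B) (v s))
      (exp ((t - s) • B) (v' s - B (v s))) s := fun s hs => by
    have hexp := (hasDerivAt_exp_smul_const B (t - s)).comp_const_sub t s
    exact (hexp.clm_apply (hv s hs)).congr_deriv (by simp; abel)
  have hnonneg : ∀ s ∈ Icc 0 t, 0 ≤ exp ((t - s) • B) (v' s - B (v s)) := fun s hs =>
    (map_zero _).symm.le.trans
      (hB.monotone_exp_smul (sub_nonneg.2 hs.2) (sub_nonneg.2 (hsup s hs)))
  simpa using le_of_hasDerivAt_nonneg ht hderiv hnonneg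

theorem le_exp_smul_apply_of_deriv_le {t : ℝ} (ht : 0 ≤ t) {v v' : ℝ → E}
    (hv : ∀ s ∈ Icc 0 t, HasDerivAt v (v' s) s) (hsub : ∀ s ∈ Icc 0 t, v' s ≤ B (v s)) :
    v t ≤ exp (t • B) (v 0) := by
  have := hB.exp_smul_apply_le_of_le_deriv ht (v := -v) (fun s hs => (hv s hs).neg)
    fun s hs => by simpa using hsub s hs
  simpa using this

theorem exists_pos_smul_le_semigroupPotential {T : ℝ} (hT : 0 < T) :
    ∃ c : ℝ, 0 < c ∧ ∀ w : E, 0 ≤ w → c • w ≤ semigroupPotential B w T := by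
  obtain ⟨D, hD⟩ := hB
  have hcont : Continuous fun r : ℝ => Real.exp (-(r * D)) := by fun_prop
  refine ⟨∫ r in (0 : ℝ)..T, Real.exp (-(r * D)), intervalIntegral.intervalIntegral_pos_of_pos
    (hcont.intervalIntegrable 0 T) (fun r => Real.exp_pos _) hT, fun w hw => ?_⟩
  have hderiv : ∀ s : ℝ, HasDerivAt
      (fun s => semigroupPotential B w s - (∫ r in (0 : ℝ)..s, Real.exp (-(r * D))) • w)
      (exp (s • B) w - Real.exp (-(s * D)) • w) s := fun s =>
    (hasDerivAt_semigroupPotential B w s).sub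
      ((hcont.integral_hasStrictDerivAt 0 s).hasDerivAt.smul_const w)
  have := le_of_hasDerivAt_nonneg hT.le (fun s _ => hderiv s) fun s hs =>
    sub_nonneg.2 (exp_neg_smul_le_exp_smul_apply hD hs.1 hw)
  simpa using this

theorem exp_add_natCast_mul_smul_apply_le {e : E} {c T : ℝ} (hT : 0 ≤ T) (hc : 0 ≤ c)
    (hle : ∀ s ∈ Icc 0 T, exp (s • B) e ≤ c • e) {s : ℝ} (hs : s ∈ Icc 0 T) (n : ℕ) :
    exp ((s + n * T) • B) e ≤ c ^ (n + 1) • e := by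
  induction n with
  | zero => simpa using hle s hs
  | succ n ih =>
    calc exp ((s + (n + 1 : ℕ) * T) • B) e
        = exp (T • B) (exp ((s + n * T) • B) e) := by
          have hsplit : s + (n + 1 : ℕ) * T = T + (s + n * T) := by push_cast; ring
          rw [hsplit]
          exact DFunLike.congr_fun (exp_add_smul B T (s + n * T)) e
      _ ≤ exp (T • B) (c ^ (n + 1) • e) := hB.monotone_exp_smul hT ih
      _ = c ^ (n + 1) • exp (T • B) e := map_smul _ _ _
      _ ≤ c ^ (n + 1) • c • e :=
        smul_le_smul_of_nonneg_left (hle T (right_mem_Icc.2 hT)) (pow_nonneg hc _)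
      _ = c ^ (n + 1 + 1) • e := by rw [smul_smul, ← pow_succ]

theorem exp_smul_apply_le_rpow {e : E} (he : 0 ≤ e) {c T : ℝ} (hT : 0 < T) (hc : 1 ≤ c)
    (hle : ∀ s ∈ Icc 0 T, exp (s • B) e ≤ c • e) {t : ℝ} (ht : 0 ≤ t) :
    exp (t • B) e ≤ c ^ (1 + t / T) • e := by
  have hfloor : ⌊t / T⌋₊ * T ≤ t := (le_div_iff₀ hT).1 (Nat.floor_le (by positivity))
  have hceil : t < (⌊t / T⌋₊ + 1) * T := (div_lt_iff₀ hT).1 (Nat.lt_floor_add_one _)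
  have hrem : t - ⌊t / T⌋₊ * T ∈ Icc 0 T := ⟨by linarith, by linarith⟩
  have hpow : c ^ (⌊t / T⌋₊ + 1) ≤ c ^ (1 + t / T) := by
    rw [← Real.rpow_natCast]
    refine Real.rpow_le_rpow_of_exponent_le hc ?_
    push_cast
    linarith [Nat.floor_le (show 0 ≤ t / T by positivity)]
  calc exp (t • B) e
      ≤ c ^ (⌊t / T⌋₊ + 1) • e := by
        simpa using hB.exp_add_natCast_mul_smul_apply_le hT.le (by linarith) hle hrem ⌊t / T⌋₊
    _ ≤ c ^ (1 + t / T) • e := smul_le_smul_of_nonneg_right hpow he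

end QuasiPositive

end OrderedBanachSpace

section NormedAlgebra

variable {A : Type*} [NormedCommRing A] [NormedAlgebra ℝ A]

/-- The carré du champ `Γ(f, g)` of an operator `L` on a commutative algebra, which measures the
failure of the Leibniz rule. -/
noncomputable def carreDuChamp (L : A →L[ℝ] A) (f g : A) : A :=
  (1 / 2 : ℝ) • (L (f * g) - f * L g - g * L f)

/-- The iterated carré du champ `Γ₂(f, g)`, in which `Γ` takes the place of the product. -/
noncomputable def iteratedCarreDuChamp (L : A →L[ℝ] A) (f g : A) : A :=
  (1 / 2 : ℝ) • (L (carreDuChamp L f g) - carreDuChamp L f (L g) - carreDuChamp L g (L f))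

theorem map_mul_self_eq_carreDuChamp (L : A →L[ℝ] A) (f : A) :
    L (f * f) = (2 : ℝ) • (carreDuChamp L f f + f * L f) := by
  rw [carreDuChamp]
  module

theorem map_carreDuChamp_self_eq_iterated (L : A →L[ℝ] A) (f : A) :
    L (carreDuChamp L f f) = (2 : ℝ) • (iteratedCarreDuChamp L f f + carreDuChamp L f (L f)) := by
  rw [iteratedCarreDuChamp]
  module

theorem hasDerivAt_carreDuChamp_self (L : A →L[ℝ] A) {u : ℝ → A} {u' : A} {s : ℝ}
    (hu : HasDerivAt u u' s) :
    HasDerivAt (fun s => carreDuChamp L (u s) (u s)) ((2 : ℝ) • carreDuChamp L (u s) u') s := by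
  have hLu : HasDerivAt (fun s => L (u s)) (L u') s := L.hasFDerivAt.comp_hasDerivAt s hu
  have hLuu : HasDerivAt (fun s => L (u s * u s)) (L (u' * u s + u s * u')) s :=
    L.hasFDerivAt.comp_hasDerivAt s (hu.mul hu)
  refine (((hLuu.sub (hu.mul hLu)).sub (hu.mul hLu)).const_smul (1 / 2 : ℝ)).congr_deriv ?_
  rw [carreDuChamp, map_add, mul_comm u' (u s)]
  module

end NormedAlgebra

section OrderedBanachAlgebra

variable {A : Type*} [NormedCommRing A] [NormedAlgebra ℝ A] [PartialOrder A] [IsOrderedRing A]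

theorem QuasiPositive.add_mul_left {L : A →L[ℝ] A} (hL : QuasiPositive L) {W : A} (hW : 0 ≤ W) :
    QuasiPositive (L + ContinuousLinearMap.mul ℝ A W) := by
  obtain ⟨D, hD⟩ := hL
  refine ⟨D, fun f g hfg => ?_⟩
  have := add_le_add (hD hfg) (mul_le_mul_of_nonneg_left hfg hW)
  simpa [add_right_comm] using this

variable [IsOrderedModule ℝ A]

/-- With `b' = 2 + 2 K b` and `u' = L u`, the left-hand side is the derivative of
`u² + b Γ(u, u)`. -/
theorem two_smul_mul_add_carreDuChamp_le {L : A →L[ℝ] A} {W u : A} {K b : ℝ} (hsq : 0 ≤ u * u)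
    (hW : 0 ≤ W)
    (hcurv : K • carreDuChamp L u u ≤ iteratedCarreDuChamp L u u + W * carreDuChamp L u u)
    (hb : 0 ≤ b) :
    (2 : ℝ) • (u * L u + b • carreDuChamp L u (L u) + (1 + K * b) • carreDuChamp L u u) ≤
      (L + ContinuousLinearMap.mul ℝ A ((2 : ℝ) • W)) (u * u + b • carreDuChamp L u u) := by
  have hgap : 0 ≤ (2 : ℝ) • (W * (u * u)) + (2 * b) • (iteratedCarreDuChamp L u u +
      W * carreDuChamp L u u - K • carreDuChamp L u u) :=
    add_nonneg (smul_nonneg zero_le_two (mul_nonneg hW hsq))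
      (smul_nonneg (mul_nonneg zero_le_two hb) (sub_nonneg.2 hcurv))
  rw [← sub_nonneg]
  convert hgap using 1
  rw [add_apply, ContinuousLinearMap.mul_apply']
  simp only [map_add, map_smul, map_mul_self_eq_carreDuChamp, map_carreDuChamp_self_eq_iterated,
    smul_mul_assoc, mul_add, mul_smul_comm]
  module

variable [CompleteSpace A] [OrderClosedTopology A]

/-- **Khas'minskii's lemma**: `1 + c ∫_0^s e^{rL} V dr` is a supersolution of `v' = (L + V) v` as
soon as `1 + cκ ≤ c`. -/
theorem exp_smul_add_mul_apply_one_le {L : A →L[ℝ] A} (hL : QuasiPositive L) (hL1 : L 1 = 0)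
    {V : A} (hV : 0 ≤ V) {κ T : ℝ} (hκ : κ < 1)
    (hpot : ∀ s ∈ Icc 0 T, semigroupPotential L V s ≤ κ • (1 : A)) {t : ℝ} (ht : t ∈ Icc 0 T) :
    exp (t • (L + ContinuousLinearMap.mul ℝ A V)) 1 ≤ (1 - κ)⁻¹ • (1 : A) := by
  set c : ℝ := (1 - κ)⁻¹ with hc
  have : 0 ≤ c := inv_nonneg.2 (sub_nonneg.2 hκ.le)
  have hcκ : 1 + c * κ = c := by
    rw [hc]
    field_simp [(sub_pos.2 hκ).ne']
    ring
  set v : ℝ → A := fun s => 1 + c • semigroupPotential L V s with hv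
  have hderiv : ∀ s, HasDerivAt v (c • exp (s • L) V) s := fun s =>
    ((hasDerivAt_semigroupPotential L V s).const_smul c).const_add 1
  have hle : ∀ s ∈ Icc 0 T, v s ≤ c • (1 : A) := fun s hs =>
    calc v s ≤ 1 + c • κ • (1 : A) := by
          simp only [hv]
          gcongr
          exact hpot s hs
      _ = (1 + c * κ) • (1 : A) := by module
      _ = c • (1 : A) := by rw [hcκ]
  have hsuper : ∀ s ∈ Icc 0 T,
      (L + ContinuousLinearMap.mul ℝ A V) (v s) ≤ c • exp (s • L) V := fun s hs =>
    calc (L + ContinuousLinearMap.mul ℝ A V) (v s)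
        = c • (exp (s • L) V - V) + V * v s := by
          simp [hv, hL1, apply_semigroupPotential]
      _ ≤ c • (exp (s • L) V - V) + V * c • (1 : A) := by
          gcongr
          exact hle s hs
      _ = c • exp (s • L) V := by
          rw [mul_smul_comm, mul_one]
          module
  calc exp (t • (L + ContinuousLinearMap.mul ℝ A V)) 1
      = exp (t • (L + ContinuousLinearMap.mul ℝ A V)) (v 0) := by simp [hv]
    _ ≤ v t := (hL.add_mul_left hV).exp_smul_apply_le_of_le_deriv ht.1 (fun s _ => hderiv s)
        fun s hs => hsuper s ⟨hs.1, hs.2.trans ht.2⟩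
    _ ≤ c • (1 : A) := hle t ht

theorem smul_carreDuChamp_exp_smul_le {L : A →L[ℝ] A} (hL : QuasiPositive L)
    (hsq : ∀ f : A, 0 ≤ f * f) {W : A} (hW : 0 ≤ W) {K : ℝ}
    (hcurv : ∀ f, K • carreDuChamp L f f ≤ iteratedCarreDuChamp L f f + W * carreDuChamp L f f)
    (f : A) {t : ℝ} (ht : 0 ≤ t) :
    (2 * ∫ r in (0 : ℝ)..t, Real.exp (2 * K * r)) •
        carreDuChamp L (exp (t • L) f) (exp (t • L) f) ≤
      exp (t • (L + ContinuousLinearMap.mul ℝ A ((2 : ℝ) • W))) (f * f) := by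
  set u : ℝ → A := fun s => exp (s • L) f with hu
  set b : ℝ → ℝ := fun s => 2 * ∫ r in (0 : ℝ)..s, Real.exp (2 * K * r) with hb
  set g : ℝ → A := fun s => u s * u s + b s • carreDuChamp L (u s) (u s) with hg
  have hb_nonneg : ∀ s, 0 ≤ s → 0 ≤ b s := fun s hs => mul_nonneg zero_le_two
    (intervalIntegral.integral_nonneg hs fun r _ => (Real.exp_pos _).le)
  have hb_deriv : ∀ s, HasDerivAt b (2 + 2 * K * b s) s := fun s => by
    have hcont : Continuous fun r : ℝ => Real.exp (2 * K * r) := by fun_prop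
    refine ((hcont.integral_hasStrictDerivAt 0 s).hasDerivAt.const_mul 2).congr_deriv ?_
    linear_combination (-2) * mul_integral_exp_mul (2 * K) s
  have hu_deriv : ∀ s, HasDerivAt u (L (u s)) s := hasDerivAt_exp_smul_apply L f
  have hg_deriv : ∀ s, HasDerivAt g ((2 : ℝ) • (u s * L (u s) + b s • carreDuChamp L (u s) (L (u s))
      + (1 + K * b s) • carreDuChamp L (u s) (u s))) s := fun s =>
    (((hu_deriv s).mul (hu_deriv s)).add
      ((hb_deriv s).smul (hasDerivAt_carreDuChamp_self L (hu_deriv s)))).congr_deriv <| by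
        rw [mul_comm (L (u s))]
        module
  calc b t • carreDuChamp L (u t) (u t)
      ≤ g t := le_add_of_nonneg_left (hsq _)
    _ ≤ exp (t • (L + ContinuousLinearMap.mul ℝ A ((2 : ℝ) • W))) (g 0) :=
        (hL.add_mul_left (smul_nonneg zero_le_two hW)).le_exp_smul_apply_of_deriv_le ht
          (fun s _ => hg_deriv s) fun s hs =>
            two_smul_mul_add_carreDuChamp_le (hsq _) hW (hcurv _) (hb_nonneg s hs.1)
    _ = exp (t • (L + ContinuousLinearMap.mul ℝ A ((2 : ℝ) • W))) (f * f) := by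
          simp only [hg, hb, hu, exp_zero_smul_apply, intervalIntegral.integral_same, mul_zero,
            zero_smul, add_zero]

theorem smul_carreDuChamp_exp_smul_le_rpow_smul_one {L : A →L[ℝ] A} (hL : QuasiPositive L)
    (hL1 : L 1 = 0) (hsq : ∀ f : A, 0 ≤ f * f) {W : A} (hW : 0 ≤ W) {K κ T : ℝ}
    (hcurv : ∀ f, K • carreDuChamp L f f ≤ iteratedCarreDuChamp L f f + W * carreDuChamp L f f)
    (hκ : κ ∈ Ico 0 (1 / 2)) (hT : 0 < T)
    (hpot : ∀ s ∈ Icc 0 T, semigroupPotential L W s ≤ κ • (1 : A))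
    {f : A} {C : ℝ} (hC : 0 ≤ C) (hf : f * f ≤ C • (1 : A)) {t : ℝ} (ht : 0 ≤ t) :
    (2 * ∫ r in (0 : ℝ)..t, Real.exp (2 * K * r)) •
        carreDuChamp L (exp (t • L) f) (exp (t • L) f) ≤
      C • (1 - 2 * κ)⁻¹ ^ (1 + t / T) • (1 : A) := by
  have hone : (0 : A) ≤ 1 := by simpa only [one_mul] using hsq 1
  have hW2 : 0 ≤ (2 : ℝ) • W := smul_nonneg zero_le_two hW
  have hB := hL.add_mul_left hW2
  have hpot2 : ∀ s ∈ Icc 0 T, semigroupPotential L ((2 : ℝ) • W) s ≤ (2 * κ) • (1 : A) :=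
    fun s hs => by
      rw [semigroupPotential_smul, mul_smul]
      exact smul_le_smul_of_nonneg_left (hpot s hs) zero_le_two
  have hc : 1 ≤ (1 - 2 * κ)⁻¹ :=
    (one_le_inv₀ (by linarith [hκ.2])).2 (by linarith [hκ.1])
  calc (2 * ∫ r in (0 : ℝ)..t, Real.exp (2 * K * r)) •
          carreDuChamp L (exp (t • L) f) (exp (t • L) f)
      ≤ exp (t • (L + ContinuousLinearMap.mul ℝ A ((2 : ℝ) • W))) (f * f) :=
        smul_carreDuChamp_exp_smul_le hL hsq hW hcurv f ht
    _ ≤ exp (t • (L + ContinuousLinearMap.mul ℝ A ((2 : ℝ) • W))) (C • (1 : A)) :=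
        hB.monotone_exp_smul ht hf
    _ = C • exp (t • (L + ContinuousLinearMap.mul ℝ A ((2 : ℝ) • W))) 1 := map_smul _ _ _
    _ ≤ C • (1 - 2 * κ)⁻¹ ^ (1 + t / T) • (1 : A) :=
        smul_le_smul_of_nonneg_left (hB.exp_smul_apply_le_rpow hone hT hc
          (fun s hs => exp_smul_add_mul_apply_one_le hL hL1 hW2 (by linarith [hκ.2]) hpot2 hs)
          ht) hC

end OrderedBanachAlgebra

namespace Linf

variable {V : Type*}

-- Scoped, so that outside `Linf` the norm of `Linf V` is still found from `NormedAddCommGroup`.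
noncomputable scoped instance : NormedCommRing (Linf V) :=
  inferInstanceAs (NormedCommRing (lp (fun _ : V => ℝ) ∞))

noncomputable scoped instance : NormedAlgebra ℝ (Linf V) :=
  inferInstanceAs (NormedAlgebra ℝ (lp (fun _ : V => ℝ) ∞))

noncomputable instance : PartialOrder (Linf V) :=
  PartialOrder.lift (β := V → ℝ) (fun f => f.1) Subtype.val_injective

theorem le_def {f g : Linf V} : f ≤ g ↔ ∀ x, f x ≤ g x := Iff.rfl

theorem zero_apply (x : V) : (0 : Linf V) x = 0 := rfl

theorem one_apply (x : V) : (1 : Linf V) x = 1 := rfl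

theorem mul_apply (f g : Linf V) (x : V) : (f * g) x = f x * g x := rfl

theorem continuous_apply (x : V) : Continuous fun f : Linf V => f x :=
  (lp.evalCLM ℝ (fun _ : V => ℝ) (p := ∞) x).continuous

instance : IsOrderedAddMonoid (Linf V) where
  add_le_add_left f g hfg h x := by simpa using hfg x

instance : IsOrderedRing (Linf V) :=
  have : ZeroLEOneClass (Linf V) := ⟨fun _ => zero_le_one⟩
  .of_mul_nonneg fun _ _ hf hg x => mul_nonneg (hf x) (hg x)

instance : IsOrderedModule ℝ (Linf V) :=
  .of_smul_nonneg fun _ hc _ hf x => mul_nonneg hc (hf x)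

instance : OrderClosedTopology (Linf V) where
  isClosed_le' := by
    simp only [le_def, Set.ofPred_forall]
    exact isClosed_iInter fun x => isClosed_le
      ((continuous_apply x).comp continuous_fst) ((continuous_apply x).comp continuous_snd)

theorem mul_self_nonneg (f : Linf V) : 0 ≤ f * f := fun x => _root_.mul_self_nonneg (f x)

theorem le_smul_one_of_norm_le {f : Linf V} {C : ℝ} (hf : ‖f‖ ≤ C) : f ≤ C • (1 : Linf V) :=
  fun x => by
    simpa [one_apply] using (le_abs_self _).trans ((f.abs_apply_le x).trans hf)

theorem mul_self_le_norm_sq_smul_one (f : Linf V) : f * f ≤ ‖f‖ ^ 2 • (1 : Linf V) :=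
  le_smul_one_of_norm_le ((norm_mul_le f f).trans_eq (sq _).symm)

end Linf

namespace MeasuredWeightedGraph

open scoped Linf

variable {V : Type*} (G : MeasuredWeightedGraph V)

theorem gam_self_eq_sum (f : V → ℝ) (x : V) :
    G.gam f f x = 1 / 2 * ∑ y ∈ G.nbrs x, G.q x y * (f y - f x) ^ 2 := by
  simp only [gam, lap, Pi.mul_apply, Finset.mul_sum, ← Finset.sum_sub_distrib]
  exact Finset.sum_congr rfl fun y _ => by ring

theorem gam_self_nonneg (f : V → ℝ) (x : V) : 0 ≤ G.gam f f x := by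
  rw [gam_self_eq_sum]
  exact mul_nonneg one_half_pos.le
    (Finset.sum_nonneg fun y _ => mul_nonneg (G.q_nonneg x y) (sq_nonneg _))

theorem lap_add_mul_nonneg {f : V → ℝ} (hf : ∀ y, 0 ≤ f y) {D : ℝ} {x : V} (hD : G.deg x ≤ D) :
    0 ≤ G.lap f x + D * f x := by
  have hsum : 0 ≤ ∑ y ∈ G.nbrs x, G.q x y * f y :=
    Finset.sum_nonneg fun y _ => mul_nonneg (G.q_nonneg x y) (hf y)
  have hlap : G.lap f x = ∑ y ∈ G.nbrs x, G.q x y * f y - G.deg x * f x := by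
    simp only [lap, deg, mul_sub, Finset.sum_sub_distrib, Finset.sum_mul]
  linarith [mul_le_mul_of_nonneg_right hD (hf x)]

variable {G}

theorem trunc_nonneg (k : ℕ) (W : V → ℝ≥0) : 0 ≤ trunc k W :=
  fun x => le_min k.cast_nonneg (W x).coe_nonneg

theorem CD.top {ρ : V → ℝ} {n : ℝ≥0∞} (h : G.CD ρ n) : G.CD ρ ∞ := fun f hf x => by
  have hdim : 0 ≤ (n⁻¹).toReal * G.lap f x ^ 2 := by positivity
  simpa only [ENNReal.inv_top, ENNReal.toReal_zero, zero_mul, add_zero] using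
    (le_add_of_nonneg_right hdim).trans (h f hf x)

theorem negPartFun_apply (f : V → ℝ) (x : V) : (negPartFun f x : ℝ) = -min 0 (f x) := rfl

namespace BoundedDegree

variable (hG : G.BoundedDegree)

theorem lapL_one : hG.lapL 1 = 0 := by
  ext x
  simp [lapL_apply, lap, Linf.one_apply, Linf.zero_apply]

theorem quasiPositive_lapL : QuasiPositive hG.lapL :=
  ⟨hG.some, (monotone_iff_map_nonneg _).2 fun _ hf x =>
    G.lap_add_mul_nonneg hf (hG.some_mem (mem_range_self x))⟩

theorem smul_carreDuChamp_lapL_le {ρ : V → ℝ} (hCD : G.CD ρ ∞) {K : ℝ} {W : Linf V}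
    (hK : ∀ x, K ≤ ρ x + W x) (f : Linf V) :
    K • carreDuChamp hG.lapL f f ≤
      iteratedCarreDuChamp hG.lapL f f + W * carreDuChamp hG.lapL f f := fun x => by
  have hCDx : ρ x * G.gam f f x ≤ G.gam2 f f x := by
    simpa only [ENNReal.inv_top, ENNReal.toReal_zero, zero_mul, add_zero] using
      hCD f ⟨‖f‖, f.abs_apply_le⟩ x
  have hmul := mul_le_mul_of_nonneg_right (hK x) (G.gam_self_nonneg f x)
  change K * G.gam f f x ≤ G.gam2 f f x + W x * G.gam f f x
  linarith

theorem semigroupPotential_lapL_trunc_le {W : V → ℝ≥0} {κ T : ℝ} (hκ : 0 ≤ κ)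
    (hKato : hG.kato T W ≤ ENNReal.ofReal κ) (k : ℕ) {s : ℝ} (hs : s ∈ Icc 0 T) :
    semigroupPotential hG.lapL (trunc k W) s ≤ κ • (1 : Linf V) := by
  refine Linf.le_smul_one_of_norm_le ((ENNReal.ofReal_le_ofReal_iff hκ).1 ?_)
  rw [ofReal_norm]
  calc ‖semigroupPotential hG.lapL (trunc k W) s‖ₑ
      ≤ ∫⁻ r in Ioc 0 T, ‖hG.heat r (trunc k W)‖ₑ := enorm_semigroupPotential_le_lintegral _ _ hs
    _ ≤ hG.kato T W := le_iSup (fun k => ∫⁻ r in Ioc 0 T, ‖hG.heat r (trunc k W)‖ₑ) k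
    _ ≤ ENNReal.ofReal κ := hKato

theorem exists_trunc_eq_of_kato_le {W : V → ℝ≥0} {κ T : ℝ} (hT : 0 < T) (hκ : 0 ≤ κ)
    (hKato : hG.kato T W ≤ ENNReal.ofReal κ) : ∃ k : ℕ, ∀ x, trunc k W x = W x := by
  obtain ⟨c, hc, hlower⟩ := hG.quasiPositive_lapL.exists_pos_smul_le_semigroupPotential hT
  obtain ⟨k, hk⟩ := exists_nat_gt (κ / c)
  refine ⟨k, fun x => min_eq_right (le_of_not_gt fun hlt => ?_)⟩
  have hle : c • trunc k W ≤ κ • (1 : Linf V) :=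
    (hlower _ (trunc_nonneg k W)).trans
      (hG.semigroupPotential_lapL_trunc_le hκ hKato k (right_mem_Icc.2 hT.le))
  have hlek : c * k ≤ κ := by
    simpa [trunc, min_eq_left hlt.le, Linf.one_apply] using hle x
  rw [div_lt_iff₀ hc] at hk
  linarith

theorem integral_mul_gam_heat_le {K T κ : ℝ} (hT : 0 < T) (hκ : κ ∈ Ico 0 (1 / 2)) {ρ : V → ℝ}
    (hCD : G.CD ρ ∞) (hKato : hG.kato T (negPartFun fun x => ρ x - K) ≤ ENNReal.ofReal κ)
    (f : Linf V) {t : ℝ} (ht : 0 ≤ t) (x : V) :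
    (2 * ∫ r in (0 : ℝ)..t, Real.exp (2 * K * r)) * G.gam (hG.heat t f) (hG.heat t f) x ≤
      ‖f‖ ^ 2 * (1 - 2 * κ)⁻¹ ^ (1 + t / T) := by
  obtain ⟨k, hk⟩ := hG.exists_trunc_eq_of_kato_le hT hκ.1 hKato
  set W : Linf V := trunc k (negPartFun fun x => ρ x - K)
  have hcurv : ∀ x, K ≤ ρ x + W x := fun x => by
    rw [hk x, negPartFun_apply]
    linarith [min_le_right 0 (ρ x - K)]
  have hbound := smul_carreDuChamp_exp_smul_le_rpow_smul_one hG.quasiPositive_lapL hG.lapL_one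
    Linf.mul_self_nonneg (trunc_nonneg _ _) (hG.smul_carreDuChamp_lapL_le hCD hcurv) hκ hT
    (fun s hs => hG.semigroupPotential_lapL_trunc_le hκ.1 hKato k hs) (sq_nonneg ‖f‖)
    f.mul_self_le_norm_sq_smul_one ht x
  have hone : (‖f‖ ^ 2 • (1 - 2 * κ)⁻¹ ^ (1 + t / T) • (1 : Linf V)) x =
      ‖f‖ ^ 2 * (1 - 2 * κ)⁻¹ ^ (1 + t / T) := by
    simp [Linf.one_apply]
  exact hbound.trans_eq hone

end BoundedDegree

end MeasuredWeightedGraph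

section Constants

variable {K T t : ℝ}

theorem two_mul_integral_exp_two_mul (hK : K ≠ 0) (t : ℝ) :
    2 * ∫ r in (0 : ℝ)..t, Real.exp (2 * K * r) = 2 * Real.exp (K * t) * Real.sinh (K * t) / K := by
  have hsq : Real.exp (2 * K * t) = Real.exp (K * t) * Real.exp (K * t) := by
    rw [← Real.exp_add]
    ring_nf
  have hinv : Real.exp (K * t) * Real.exp (-(K * t)) = 1 := by
    rw [← Real.exp_add, add_neg_cancel, Real.exp_zero]
  rw [eq_div_iff hK, Real.sinh_eq]
  linear_combination mul_integral_exp_mul (2 * K) t + hsq + hinv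

theorem inv_rpow_le_exp {b : ℝ} (hb : Real.exp (-(K * T / 2)) ≤ b) (hT : 0 < T) (ht : 0 ≤ t) :
    b⁻¹ ^ (1 + t / T) ≤ Real.exp (K * T / 2 + K * t / 2) := by
  have hb_pos : 0 < b := (Real.exp_pos _).trans_le hb
  calc b⁻¹ ^ (1 + t / T)
      ≤ (Real.exp (-(K * T / 2)))⁻¹ ^ (1 + t / T) := by gcongr
    _ = Real.exp (K * T / 2 + K * t / 2) := by
        rw [← Real.exp_neg, neg_neg, ← Real.exp_mul]
        congr 1
        field_simp

theorem inv_rpow_div_integral_le {b : ℝ} (hb : Real.exp (-(K * T / 2)) ≤ b) (hK : 0 < K)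
    (hT : 0 < T) (ht : 0 < t) :
    b⁻¹ ^ (1 + t / T) / (2 * ∫ r in (0 : ℝ)..t, Real.exp (2 * K * r)) ≤
      K * Real.exp (K * T) * (1 / Real.sinh (K * t)) := by
  have : 0 < Real.sinh (K * t) := Real.sinh_pos_iff.2 (mul_pos hK ht)
  rw [two_mul_integral_exp_two_mul hK.ne', div_le_iff₀ (by positivity)]
  calc b⁻¹ ^ (1 + t / T)
      ≤ Real.exp (K * T / 2 + K * t / 2) := inv_rpow_le_exp hb hT ht.le
    _ ≤ Real.exp (K * T) * Real.exp (K * t) := by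
        rw [← Real.exp_add, Real.exp_le_exp]
        linarith [mul_pos hK hT, mul_pos hK ht]
    _ ≤ 2 * (Real.exp (K * T) * Real.exp (K * t)) :=
        le_mul_of_one_le_left (by positivity) one_le_two
    _ = K * Real.exp (K * T) * (1 / Real.sinh (K * t)) *
          (2 * Real.exp (K * t) * Real.sinh (K * t) / K) := by
        field_simp

theorem mul_exp_mul_one_div_sinh_le (hK : 0 < K) (ht : 0 < t) (T : ℝ) :
    K * Real.exp (K * T) * (1 / Real.sinh (K * t)) ≤ Real.exp (K * T) / t := by
  have hKt : 0 < K * t := mul_pos hK ht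
  calc K * Real.exp (K * T) * (1 / Real.sinh (K * t))
      ≤ K * Real.exp (K * T) * (1 / (K * t)) := by
        gcongr
        exact Real.self_le_sinh_iff.2 hKt.le
    _ = Real.exp (K * T) / t := by
        field_simp

end Constants

theorem mainTheorem9_general {V : Type*} {G : MeasuredWeightedGraph V}
    (hG : G.BoundedDegree) {K T κ : ℝ} (hT : 0 < T) (hκ : κ ∈ Ico 0 (1 / 2)) {ρ : V → ℝ}
    (hCD : G.CD ρ ∞)
    (hKato :
      hG.kato T (MeasuredWeightedGraph.negPartFun fun x => ρ x - K) ≤ ENNReal.ofReal κ)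
    (f : Linf V) {t : ℝ} (ht : 0 < t) (x : V) :
    G.gam (hG.heat t f) (hG.heat t f) x ≤
      (1 - 2 * κ)⁻¹ ^ (1 + t / T) / (2 * ∫ r in (0 : ℝ)..t, Real.exp (2 * K * r)) * ‖f‖ ^ 2 := by
  have hint_pos : 0 < 2 * ∫ r in (0 : ℝ)..t, Real.exp (2 * K * r) :=
    mul_pos two_pos (intervalIntegral.intervalIntegral_pos_of_pos
      (Continuous.intervalIntegrable (by fun_prop) 0 t) (fun r => Real.exp_pos _) ht)
  rw [div_mul_eq_mul_div, le_div_iff₀' hint_pos, mul_comm _ (‖f‖ ^ 2)]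
  exact hG.integral_mul_gam_heat_le hT hκ hCD hKato f ht.le x

theorem mainTheorem9 {V : Type*} (G : MeasuredWeightedGraph V) (hG : G.BoundedDegree)
    (K T : ℝ) (hK : 0 < K) (hT : 0 < T) (n : ℝ≥0∞) (hn : 0 < n) (ρ : V → ℝ)
    (hCD : G.CD ρ n)
    (hKato : hG.kato T (MeasuredWeightedGraph.negPartFun fun x => ρ x - K) ≤
      ENNReal.ofReal (1 / 4 * (1 - Real.exp (-(K * T / 2)))))
    (f : Linf V) (t : ℝ) (ht : 0 < t) :
    (∀ x : V, G.gam (hG.heat t f) (hG.heat t f) x ≤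
      K * Real.exp (K * T) * (1 / Real.sinh (K * t)) * ‖f‖ ^ 2) ∧
    K * Real.exp (K * T) * (1 / Real.sinh (K * t)) * ‖f‖ ^ 2 ≤
      Real.exp (K * T) / t * ‖f‖ ^ 2 := by
  have hexp_pos : 0 < Real.exp (-(K * T / 2)) := Real.exp_pos _
  have hexp_le : Real.exp (-(K * T / 2)) ≤ 1 :=
    Real.exp_le_one_iff.2 (by linarith [mul_pos hK hT])
  have hκ : 1 / 4 * (1 - Real.exp (-(K * T / 2))) ∈ Ico (0 : ℝ) (1 / 2) :=
    ⟨by linarith, by linarith⟩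
  exact ⟨fun x => (mainTheorem9_general hG hT hκ hCD.top hKato f ht x).trans
      (mul_le_mul_of_nonneg_right (inv_rpow_div_integral_le (by linarith) hK hT ht) (sq_nonneg _)),
    mul_le_mul_of_nonneg_right (mul_exp_mul_one_div_sinh_le hK ht T) (sq_nonneg _)⟩
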